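/- Let $\Xi$ be a nonempty complete separable metric space (the mark space). A \emph{network} is a connected, locally finite multigraph $G=(V,E)$ (loops and multiple edges allowed) together with a mark in $\Xi$ for every vertex $v\in V$ and for every pair $(v,e)$ consisting of an edge $e\in E$ and an end point $v$ of $e$. An isomorphism of networks is an isomorphism of multigraphs that preserves the marks. Let $\mathcal G$ be the set of isomorphism classes $[G]$ of networks, and let $\mathcal G_*$ be the set of isomorphism classes $[G,o]$ of networks with a distinguished vertex $o$ (the root), where isomorphisms are also required to map root to root. Equip $\mathcal G_*$ with the metric in which the distance of $[G_1,o_1]$ and $[G_2,o_2]$ is $1/(1+\alpha)$, where $\alpha\in[0,\infty]$ is the supremum of those $r>0$ for which there is a root-preserving multigraph isomorphism between the subnetworks induced on the balls of (graph-distance) radius $\lfloor r\rfloor$ around $o_1$ and $o_2$ such that each pair of corresponding marks has distance less than $1/r$ (with $\alpha=0$ if there is no such $r$, and $1/(1+\infty)=0$), and with the corresponding Borel sigma-field. Let $\pi:\mathcal G_*\to\mathcal G$, $\pi[G,o]:=[G]$, and $$J:=\{B\subseteq\mathcal G:\ \pi^{-1}(B)\text{ is measurable in }\mathcal G_*\}.$$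 \textbf{Proposition.} The measurable space $(\mathcal G,J)$ is not a standard Borel space. More precisely, there is no metric on $\mathcal G$ that makes it a Polish space whose Borel sigma-field is $J$. -/

import Mathlib

open scoped NNReal ENNReal

universe u

/-- A multigraph (loops and multiple edges allowed; an edge has an unordered pair of end points)
with marks in `Ξ` on its vertices `v` and on its incident pairs `(v, e)`. -/
structure MarkedGraph (Ξ : Type u) where
  /-- vertices -/
  V : Type
  /-- edges -/
  E : Type
  /-- the end points of an edge -/
  ends : E → Sym2 V
  /-- marks of the vertices -/
  vertexMark : V → Ξ
  /-- marks of the pairs `(v, e)` with `v` an end point of `e` -/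
  edgeMark : (v : V) → (e : E) → v ∈ ends e → Ξ

namespace MarkedGraph

/-- The adjacency relation between distinct vertices. -/
def skeleton {Ξ : Type u} (G : MarkedGraph Ξ) : SimpleGraph G.V where
  Adj v w := v ≠ w ∧ ∃ e : G.E, G.ends e = s(v, w)
  symm := ⟨fun _ _ h => ⟨h.1.symm, h.2.imp fun _ he => he.trans Sym2.eq_swap⟩⟩
  loopless := ⟨fun _ h => h.1 rfl⟩

/-- The subnetwork induced on a set `S` of vertices: all vertices in `S` and all edges with both
end points in `S`, with the marks inherited. -/
def induce {Ξ : Type u} (G : MarkedGraph Ξ) (S : Set G.V) : MarkedGraph Ξ where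
  V := {v : G.V // v ∈ S}
  E := {e : G.E // ∀ v ∈ G.ends e, v ∈ S}
  ends e := (G.ends e.1).attachWith e.2
  vertexMark v := G.vertexMark v.1
  edgeMark v e h := G.edgeMark v.1 e.1 (by
    rw [← Sym2.attachWith_map_subtypeVal e.2]
    exact Sym2.mem_map.2 ⟨v, h, rfl⟩)

/-- An isomorphism of the underlying multigraphs; marks are not taken into account. -/
structure GraphIso {Ξ : Type u} (G H : MarkedGraph Ξ) where
  /-- the bijection of the vertices -/
  onV : G.V ≃ H.V
  /-- the bijection of the edges -/
  onE : G.E ≃ H.E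
  ends_map : ∀ e, H.ends (onE e) = (G.ends e).map onV

namespace GraphIso

variable {Ξ : Type u} {G H K : MarkedGraph Ξ}

theorem mem_ends (φ : GraphIso G H) {v : G.V} {e : G.E} (h : v ∈ G.ends e) :
    φ.onV v ∈ H.ends (φ.onE e) := by
  rw [φ.ends_map]
  exact Sym2.mem_map.2 ⟨v, h, rfl⟩

/-- The identity. -/
def refl (G : MarkedGraph Ξ) : GraphIso G G where
  onV := Equiv.refl _
  onE := Equiv.refl _
  ends_map _ := (congrFun Sym2.map_id _).symm

/-- The inverse. -/
def symm (φ : GraphIso G H) : GraphIso H G where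
  onV := φ.onV.symm
  onE := φ.onE.symm
  ends_map e := by
    have h := φ.ends_map (φ.onE.symm e)
    rw [Equiv.apply_symm_apply] at h
    rw [h, Sym2.map_map]
    simp

/-- The composition. -/
def trans (φ : GraphIso G H) (ψ : GraphIso H K) : GraphIso G K where
  onV := φ.onV.trans ψ.onV
  onE := φ.onE.trans ψ.onE
  ends_map e := by
    simp [ψ.ends_map, φ.ends_map, Sym2.map_map]

/-- The isomorphism preserves all marks. -/
def PreservesMarks (φ : GraphIso G H) : Prop :=
  (∀ v, H.vertexMark (φ.onV v) = G.vertexMark v) ∧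
    ∀ v e (h : v ∈ G.ends e),
      H.edgeMark (φ.onV v) (φ.onE e) (φ.mem_ends h) = G.edgeMark v e h

/-- Each pair of corresponding marks has distance less than `ε`. -/
def MarksWithin [MetricSpace Ξ] (φ : GraphIso G H) (ε : ℝ) : Prop :=
  (∀ v, dist (H.vertexMark (φ.onV v)) (G.vertexMark v) < ε) ∧
    ∀ v e (h : v ∈ G.ends e),
      dist (H.edgeMark (φ.onV v) (φ.onE e) (φ.mem_ends h)) (G.edgeMark v e h) < ε

theorem edgeMark_congr {v v' : G.V} {e e' : G.E} (hv : v = v') (he : e = e')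
    (h : v ∈ G.ends e) (h' : v' ∈ G.ends e') : G.edgeMark v e h = G.edgeMark v' e' h' := by
  subst hv he
  rfl

theorem PreservesMarks.symm {φ : GraphIso G H} (hφ : φ.PreservesMarks) :
    φ.symm.PreservesMarks := by
  refine ⟨fun v => ?_, fun v e h => ?_⟩
  · have := hφ.1 (φ.onV.symm v)
    rw [Equiv.apply_symm_apply] at this
    exact this.symm
  · have := hφ.2 (φ.onV.symm v) (φ.onE.symm e) (φ.symm.mem_ends h)
    refine this.symm.trans (edgeMark_congr ?_ ?_ _ _) <;> simp

theorem PreservesMarks.trans {φ : GraphIso G H} {ψ : GraphIso H K} (hφ : φ.PreservesMarks)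
    (hψ : ψ.PreservesMarks) : (φ.trans ψ).PreservesMarks :=
  ⟨fun v => (hψ.1 _).trans (hφ.1 v), fun v e h => (hψ.2 _ _ (φ.mem_ends h)).trans (hφ.2 v e h)⟩

theorem MarksWithin.trans_right [MetricSpace Ξ] {φ : GraphIso G H} {ψ : GraphIso H K} {ε : ℝ}
    (hφ : φ.MarksWithin ε) (hψ : ψ.PreservesMarks) : (φ.trans ψ).MarksWithin ε := by
  refine ⟨fun v => ?_, fun v e h => ?_⟩
  · have := hφ.1 v
    rwa [← hψ.1] at this
  · have := hφ.2 v e h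
    rwa [← hψ.2 _ _ (φ.mem_ends h)] at this

theorem MarksWithin.trans_left [MetricSpace Ξ] {φ : GraphIso G H} {ψ : GraphIso H K} {ε : ℝ}
    (hφ : φ.PreservesMarks) (hψ : ψ.MarksWithin ε) : (φ.trans ψ).MarksWithin ε := by
  refine ⟨fun v => ?_, fun v e h => ?_⟩
  · have := hψ.1 (φ.onV v)
    rwa [hφ.1] at this
  · have := hψ.2 _ _ (φ.mem_ends h)
    rwa [hφ.2 v e h] at this

theorem adj_map (φ : GraphIso G H) {v w : G.V} (h : G.skeleton.Adj v w) :
    H.skeleton.Adj (φ.onV v) (φ.onV w) := by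
  obtain ⟨hne, e, he⟩ := h
  exact ⟨φ.onV.injective.ne hne, φ.onE e, by rw [φ.ends_map, he, Sym2.map_mk]⟩

theorem edist_map_le (φ : GraphIso G H) (v w : G.V) :
    H.skeleton.edist (φ.onV v) (φ.onV w) ≤ G.skeleton.edist v w := by
  rw [G.skeleton.edist_eq_sInf]
  refine le_sInf ?_
  rintro _ ⟨p, rfl⟩
  let f : G.skeleton →g H.skeleton := ⟨φ.onV, fun h => φ.adj_map h⟩
  have := (p.map f).edist_le
  rwa [SimpleGraph.Walk.length_map] at this

theorem edist_map (φ : GraphIso G H) (v w : G.V) :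
    H.skeleton.edist (φ.onV v) (φ.onV w) = G.skeleton.edist v w := by
  refine le_antisymm (φ.edist_map_le v w) ?_
  have := φ.symm.edist_map_le (φ.onV v) (φ.onV w)
  simpa [GraphIso.symm] using this

/-- The restriction of an isomorphism to induced subnetworks. -/
def restrict (φ : GraphIso G H) (S : Set G.V) (T : Set H.V) (hST : ∀ v, v ∈ S ↔ φ.onV v ∈ T) :
    GraphIso (G.induce S) (H.induce T) where
  onV := φ.onV.subtypeEquiv hST
  onE := φ.onE.subtypeEquiv fun e => by
    rw [φ.ends_map]
    simp only [Sym2.mem_map, forall_exists_index, and_imp, forall_apply_eq_imp_iff₂]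
    exact forall₂_congr fun v _ => hST v
  ends_map e := by
    apply Sym2.map.injective Subtype.val_injective
    simp only [induce, Sym2.attachWith_map_subtypeVal, Sym2.map_map]
    refine (φ.ends_map e.1).trans ?_
    conv_lhs => rw [← Sym2.attachWith_map_subtypeVal e.2, Sym2.map_map]
    rfl

theorem PreservesMarks.restrict {φ : GraphIso G H} (hφ : φ.PreservesMarks) (S : Set G.V)
    (T : Set H.V) (hST : ∀ v, v ∈ S ↔ φ.onV v ∈ T) : (φ.restrict S T hST).PreservesMarks :=
  ⟨fun v => hφ.1 v.1, fun v e _ => hφ.2 v.1 e.1 _⟩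

end GraphIso

end MarkedGraph

/-- A network with mark space `Ξ`: a connected (in particular nonempty), locally finite marked
multigraph. -/
structure Network (Ξ : Type u) extends MarkedGraph Ξ where
  connected : toMarkedGraph.skeleton.Connected
  locallyFinite : ∀ v, {e | v ∈ ends e}.Finite

/-- A rooted network. -/
structure RootedNetwork (Ξ : Type u) extends Network Ξ where
  root : V

/-- Isomorphism of networks. -/
instance Network.isoSetoid (Ξ : Type u) : Setoid (Network Ξ) where
  r G H := ∃ φ : MarkedGraph.GraphIso G.toMarkedGraph H.toMarkedGraph, φ.PreservesMarks
  iseqv :=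
    { refl := fun _ => ⟨.refl _, fun _ => rfl, fun _ _ _ => rfl⟩
      symm := fun ⟨φ, hφ⟩ => ⟨φ.symm, hφ.symm⟩
      trans := fun ⟨φ, hφ⟩ ⟨ψ, hψ⟩ => ⟨φ.trans ψ, hφ.trans hψ⟩ }

/-- Isomorphism of rooted networks. -/
instance RootedNetwork.isoSetoid (Ξ : Type u) : Setoid (RootedNetwork Ξ) where
  r G H := ∃ φ : MarkedGraph.GraphIso G.toMarkedGraph H.toMarkedGraph,
    φ.PreservesMarks ∧ φ.onV G.root = H.root
  iseqv :=
    { refl := fun _ => ⟨.refl _, ⟨fun _ => rfl, fun _ _ _ => rfl⟩, rfl⟩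
      symm := fun ⟨φ, hφ, h⟩ => ⟨φ.symm, hφ.symm, φ.onV.symm_apply_eq.2 h.symm⟩
      trans := fun ⟨φ, hφ, h⟩ ⟨ψ, hψ, h'⟩ =>
        ⟨φ.trans ψ, hφ.trans hψ, (congrArg ψ.onV h).trans h'⟩ }

/-- The space `𝒢` of isomorphism classes of (non-rooted) networks. -/
def NonRootedSpace (Ξ : Type u) : Type (max 1 u) := Quotient (Network.isoSetoid Ξ)

/-- The space `𝒢_*` of isomorphism classes of rooted networks. -/
def RootedSpace (Ξ : Type u) : Type (max 1 u) := Quotient (RootedNetwork.isoSetoid Ξ)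

namespace RootedNetwork

variable {Ξ : Type u}

/-- The vertices at graph-distance at most `n` from the root. -/
def ballSet (G : RootedNetwork Ξ) (n : ℕ) : Set G.V :=
  {v | G.skeleton.edist G.root v ≤ n}

/-- The ball of radius `n` around the root, as an induced subnetwork. -/
def ball (G : RootedNetwork Ξ) (n : ℕ) : MarkedGraph Ξ :=
  G.toMarkedGraph.induce (G.ballSet n)

/-- The root as a vertex of a ball. -/
def ballRoot (G : RootedNetwork Ξ) (n : ℕ) : (G.ball n).V :=
  ⟨G.root, by simp [ballSet]⟩

theorem exists_ball_iso {G H : RootedNetwork Ξ} (h : G ≈ H) (n : ℕ) :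
    ∃ φ : MarkedGraph.GraphIso (G.ball n) (H.ball n),
      φ.PreservesMarks ∧ φ.onV (G.ballRoot n) = H.ballRoot n := by
  obtain ⟨φ, hφ, h0⟩ := h
  have hST : ∀ v, v ∈ G.ballSet n ↔ φ.onV v ∈ H.ballSet n := fun v => by
    simp only [ballSet, Set.mem_ofPred_eq]
    rw [← h0, φ.edist_map]
  exact ⟨φ.restrict _ _ hST, hφ.restrict _ _ hST, Subtype.ext h0⟩

variable [MetricSpace Ξ]

/-- There is a rooted isomorphism of the balls of radius `⌊r⌋` around the roots such that each
pair of corresponding marks has distance less than `1 / r`. -/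
def AgreesUpTo (r : ℝ≥0) (G H : RootedNetwork Ξ) : Prop :=
  ∃ φ : MarkedGraph.GraphIso (G.ball ⌊r⌋₊) (H.ball ⌊r⌋₊),
    φ.onV (G.ballRoot ⌊r⌋₊) = H.ballRoot ⌊r⌋₊ ∧ φ.MarksWithin (1 / (r : ℝ))

theorem AgreesUpTo.congr {r : ℝ≥0} {G H G' H' : RootedNetwork Ξ} (hG : G ≈ G') (hH : H ≈ H')
    (h : AgreesUpTo r G H) : AgreesUpTo r G' H' := by
  obtain ⟨φ, h0, hφ⟩ := h
  obtain ⟨α, hα, hα0⟩ := exists_ball_iso (Setoid.symm hG) ⌊r⌋₊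
  obtain ⟨β, hβ, hβ0⟩ := exists_ball_iso hH ⌊r⌋₊
  refine ⟨α.trans (φ.trans β), ?_, .trans_left hα (hφ.trans_right hβ)⟩
  change β.onV (φ.onV (α.onV _)) = _
  rw [hα0, h0, hβ0]

end RootedNetwork

namespace RootedSpace

variable {Ξ : Type u} [MetricSpace Ξ]

/-- `AgreesUpTo` on isomorphism classes. -/
def AgreesUpTo (r : ℝ≥0) (x y : RootedSpace Ξ) : Prop :=
  Quotient.liftOn₂ x y (RootedNetwork.AgreesUpTo r) fun _ _ _ _ hG hH =>
    propext ⟨.congr hG hH, .congr (Setoid.symm hG) (Setoid.symm hH)⟩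

/-- The supremum in `[0, ∞]` of those `r > 0` up to which two classes agree. -/
noncomputable def agreement (x y : RootedSpace Ξ) : ℝ≥0∞ :=
  ⨆ (r : ℝ≥0) (_ : 0 < r ∧ AgreesUpTo r x y), (r : ℝ≥0∞)

/-- The local distance `1 / (1 + α)`, where `α` is the agreement. -/
noncomputable def localDist (x y : RootedSpace Ξ) : ℝ :=
  (1 / (1 + agreement x y)).toReal

/-- The topology of the metric `localDist`. -/
instance : TopologicalSpace (RootedSpace Ξ) where
  IsOpen U := ∀ x ∈ U, ∃ ε > 0, ∀ y, localDist x y < ε → y ∈ U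
  isOpen_univ := fun _ _ => ⟨1, one_pos, fun _ _ => trivial⟩
  isOpen_inter := fun _ _ hU hW x hx => by
    obtain ⟨ε, hε, h⟩ := hU x hx.1
    obtain ⟨δ, hδ, h'⟩ := hW x hx.2
    exact ⟨min ε δ, lt_min hε hδ, fun y hy =>
      ⟨h y (hy.trans_le (min_le_left _ _)), h' y (hy.trans_le (min_le_right _ _))⟩⟩
  isOpen_sUnion := fun _ hs x ⟨U, hU, hx⟩ => by
    obtain ⟨ε, hε, h⟩ := hs U hU x hx
    exact ⟨ε, hε, fun y hy => ⟨U, hU, h y hy⟩⟩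

/-- The Borel sigma-field on `𝒢_*`. -/
instance : MeasurableSpace (RootedSpace Ξ) := borel _

end RootedSpace

/-- The projection `π : 𝒢_* → 𝒢`, `[G, o] ↦ [G]`, that forgets the root. -/
def forgetRoot {Ξ : Type u} : RootedSpace Ξ → NonRootedSpace Ξ :=
  Quotient.lift (fun G => Quotient.mk (Network.isoSetoid Ξ) G.toNetwork) fun _ _ ⟨φ, hφ, _⟩ =>
    Quotient.sound (s := Network.isoSetoid Ξ) ⟨φ, hφ⟩

/-- The sigma-field `J` on `𝒢`: a set is measurable iff its preimage under `π` is. -/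
instance sigmaJ (Ξ : Type u) [MetricSpace Ξ] : MeasurableSpace (NonRootedSpace Ξ) :=
  MeasurableSpace.map forgetRoot (borel (RootedSpace Ξ))

/-! A sequence `c : ℤ → Bool` is encoded as the line on `ℤ` in which the edge from `n` to `n + 1` is
doubled exactly when `c n` is true; all marks equal one fixed `ξ`. Rooting at `0` gives a continuous
map into `𝒢_*`. Forgetting the root gives a measurable map into `(𝒢, J)` that is invariant under the
shift, since a shift only moves the root. Its fibres are countable, because an isomorphism of lines
is a translation or a reflection.

A standard Borel space is countably separated, hence injects measurably into the Cantor space. The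
composite with the encoding would be a shift-invariant Borel function. The shift is topologically
transitive, so by the zero-one law for Baire category this function is constant on a comeagre set.
By injectivity that set lies in one fibre, so it is countable, which is impossible in a nonempty
Baire T1 space without isolated points. -/

open Filter Topology

/-! ### Baire category and the topological zero-one law -/

section BaireCategory

variable {X : Type*} [TopologicalSpace X] [BaireSpace X]

/-- The topological zero-one law: for a topologically transitive family of homeomorphisms, an
invariant Borel set is meagre or comeagre. -/
theorem MeasurableSet.mem_residual_or_compl_of_invariant [MeasurableSpace X] [BorelSpace X]
    {ι : Type*} (T : ι → X ≃ₜ X)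
    (hT : ∀ U W : Set X, IsOpen U → IsOpen W → U.Nonempty → W.Nonempty →
      ∃ i, (T i ⁻¹' U ∩ W).Nonempty)
    {s : Set X} (hs : MeasurableSet s) (hinv : ∀ i x, T i x ∈ s ↔ x ∈ s) :
    s ∈ residual X ∨ sᶜ ∈ residual X := by
  obtain ⟨U, hU, hsU⟩ := hs.residualEq_isOpen
  obtain ⟨W, hW, hsW⟩ := hs.compl.residualEq_isOpen
  rw [Filter.eventuallyEq_set] at hsU hsW
  rcases U.eq_empty_or_nonempty with rfl | hUne
  · right
    filter_upwards [hsU] with x hx using fun h => (hx.1 h).elim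
  rcases W.eq_empty_or_nonempty with rfl | hWne
  · left
    filter_upwards [hsW] with x hx
    by_contra h
    exact hx.1 h
  -- If neither open set is empty, a generic point `x` of `W` with `T i x ∈ U` satisfies `x ∉ s` but
  -- `T i x ∈ s`, against invariance.
  obtain ⟨i, hi⟩ := hT U W hU hW hUne hWne
  have hsU' : ∀ᶠ x in residual X, T i x ∈ s ↔ T i x ∈ U :=
    (tendsto_residual_of_isOpenMap (T i).continuous (T i).isOpenMap).eventually hsU
  obtain ⟨x, ⟨hxU, hxW⟩, hx⟩ := (dense_of_mem_residual (hsU'.and hsW)).inter_open_nonempty _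
    ((hU.preimage (T i).continuous).inter hW) hi
  exact absurd ((hinv i x).1 (hx.1.2 hxU)) (hx.2.2 hxW)

/-- For a topologically transitive family of homeomorphisms, an invariant Borel function into the
Cantor space is constant on a comeagre set. -/
theorem Measurable.exists_residual_eq_const_of_invariant [MeasurableSpace X] [BorelSpace X]
    {ι : Type*} (T : ι → X ≃ₜ X)
    (hT : ∀ U W : Set X, IsOpen U → IsOpen W → U.Nonempty → W.Nonempty →
      ∃ i, (T i ⁻¹' U ∩ W).Nonempty)
    {g : X → ℕ → Bool} (hg : Measurable g) (hinv : ∀ i x, g (T i x) = g x) :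
    ∃ y, ∀ᶠ x in residual X, g x = y := by
  have h (n : ℕ) : ∃ b, ∀ᶠ x in residual X, g x n = b := by
    have hm : MeasurableSet {x | g x n = true} :=
      ((measurable_pi_apply n).comp hg) (measurableSet_singleton true)
    rcases hm.mem_residual_or_compl_of_invariant T hT
      (fun i x => by simp only [Set.mem_ofPred_eq, hinv]) with h | h
    · exact ⟨true, h⟩
    · refine ⟨false, ?_⟩
      filter_upwards [h] with x hx using Bool.eq_false_of_not_eq_true hx
  choose y hy using h
  refine ⟨y, ?_⟩
  filter_upwards [eventually_countable_forall.2 hy] with x hx using funext hx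

/-- In a nonempty Baire space without isolated points, a comeagre set is uncountable. -/
theorem Set.not_countable_of_mem_residual [T1Space X] [Nonempty X] [∀ x : X, (𝓝[≠] x).NeBot]
    {s : Set X} (hs : s ∈ residual X) : ¬ s.Countable := fun hc => by
  have h : ∀ᶠ x in residual X, ∀ y ∈ s, x ≠ y :=
    (eventually_countable_ball hc).2 fun y _ =>
      residual_of_dense_open isOpen_compl_singleton (dense_compl_singleton y)
  obtain ⟨x, hx, hxs⟩ := (dense_of_mem_residual (h.and hs)).nonempty
  exact hx x hxs rfl

end BaireCategory

/-! ### Dynamics of the shift on bi-infinite sequences -/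

section Shift

/-- The shift by `k` of bi-infinite sequences. -/
def shiftHomeomorph (A : Type*) [TopologicalSpace A] (k : ℤ) : (ℤ → A) ≃ₜ (ℤ → A) where
  toFun c n := c (n + k)
  invFun c n := c (n - k)
  left_inv c := by ext; simp
  right_inv c := by ext; simp
  continuous_toFun := by fun_prop
  continuous_invFun := by fun_prop

theorem shiftHomeomorph_apply {A : Type*} [TopologicalSpace A] (k : ℤ) (c : ℤ → A) (n : ℤ) :
    shiftHomeomorph A k c n = c (n + k) := rfl

/-- The shift on bi-infinite sequences is topologically transitive. -/
theorem exists_shiftHomeomorph_preimage_inter_nonempty {A : Type*} [TopologicalSpace A]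
    (U W : Set (ℤ → A)) (hU : IsOpen U) (hW : IsOpen W) (hUne : U.Nonempty) (hWne : W.Nonempty) :
    ∃ k, (shiftHomeomorph A k ⁻¹' U ∩ W).Nonempty := by
  obtain ⟨a, ha⟩ := hUne
  obtain ⟨b, hb⟩ := hWne
  obtain ⟨I, u, hu, hI⟩ := isOpen_pi_iff.1 hU a ha
  obtain ⟨J, w, hw, hJ⟩ := isOpen_pi_iff.1 hW b hb
  -- Avoiding all differences `j - i` makes `I + k` disjoint from `J`, so both finite sets of
  -- constraints can be met by one sequence.
  obtain ⟨k, hk⟩ := (Finset.image₂ (fun j i => j - i) J I).exists_notMem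
  have hk' : ∀ i ∈ I, i + k ∉ J := fun i hi hj =>
    hk (Finset.mem_image₂.2 ⟨i + k, hj, i, hi, by ring⟩)
  classical
  refine ⟨k, fun n => if n ∈ J then b n else a (n - k), hI fun i hi => ?_, hJ fun j hj => ?_⟩
  · simpa [shiftHomeomorph_apply, hk' i hi] using (hu i hi).2
  · simpa [Finset.mem_coe.1 hj] using (hw j hj).2

instance nhdsNE_neBot_pi {ι A : Type*} [Infinite ι] [Nontrivial A] [TopologicalSpace A]
    (x : ι → A) : (𝓝[≠] x).NeBot := by
  rw [← mem_closure_iff_nhdsWithin_neBot, mem_closure_iff]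
  intro U hU hx
  obtain ⟨I, u, hu, hI⟩ := isOpen_pi_iff.1 hU x hx
  obtain ⟨k, hk⟩ := I.exists_notMem
  obtain ⟨b, hb⟩ := exists_ne (x k)
  classical
  refine ⟨Function.update x k b, hI fun i hi => ?_, fun h => hb ?_⟩
  · rw [Function.update_of_ne (show i ≠ k from fun e => hk (e ▸ Finset.mem_coe.1 hi))]
    exact (hu i hi).2
  · simpa using congrFun h k

end Shift

/-! ### Rigidity and distances of the integer line -/

section IntegerLine

/-- An injective self-map of `ℤ` that maps neighbours to neighbours is a translation or a
reflection. -/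
theorem Int.eq_add_or_eq_sub_of_injective {f : ℤ → ℤ} (hf : Function.Injective f)
    (h : ∀ n, f (n + 1) = f n + 1 ∨ f (n + 1) = f n - 1) :
    (∀ n, f n = f 0 + n) ∨ ∀ n, f n = f 0 - n := by
  -- Injectivity forbids turning back, so consecutive steps are equal.
  have key (n : ℤ) : f (n + 1 + 1) - f (n + 1) = f (n + 1) - f n := by
    have hne : f (n + 1 + 1) ≠ f n := fun e => by
      have := hf e
      omega
    have := h n
    have := h (n + 1)
    omega
  have hD (n : ℤ) : f (n + 1) - f n = f 1 - f 0 := by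
    induction n using Int.induction_on with
    | zero => simp
    | succ i ih => rw [key, ih]
    | pred i ih =>
      have := key (-i - 1)
      simp only [sub_add_cancel] at this ⊢
      omega
  have hlin (n : ℤ) : f n = f 0 + n * (f 1 - f 0) := by
    induction n using Int.induction_on with
    | zero => simp
    | succ i ih => linarith [hD i]
    | pred i ih =>
      have := hD (-i - 1)
      simp only [sub_add_cancel] at this
      linarith
  have h0 := h 0
  rw [zero_add] at h0
  rcases h0 with e | e
  · left
    intro n
    rw [hlin n, e]
    ring
  · right
    intro n
    rw [hlin n, e]
    ring

end IntegerLine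

theorem SimpleGraph.Walk.abs_sub_le_length {G : SimpleGraph ℤ}
    (hG : ∀ a b, G.Adj a b → b = a + 1 ∨ a = b + 1) {v w : ℤ} (p : G.Walk v w) :
    |w - v| ≤ p.length := by
  induction p with
  | nil => simp
  | cons h p ih =>
    rw [SimpleGraph.Walk.length_cons]
    have := hG _ _ h
    rw [abs_le] at ih ⊢
    push_cast
    constructor <;> omega

/-! ### Lines with single and double edges -/

namespace MarkedGraph

variable {Ξ : Type u}

/-- The marked graph on `ℤ` with one or two edges between `n` and `n + 1`, according to `c n`, and
with constant marks. -/
def line (ξ : Ξ) (c : ℤ → Bool) : MarkedGraph Ξ where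
  V := ℤ
  E := {p : ℤ × Bool // p.2 = true → c p.1 = true}
  ends e := s(e.1.1, e.1.1 + 1)
  vertexMark _ := ξ
  edgeMark _ _ _ := ξ

variable (ξ : Ξ) (c d : ℤ → Bool)

theorem line_skeleton_adj (v w : ℤ) :
    (line ξ c).skeleton.Adj v w ↔ w = v + 1 ∨ v = w + 1 := by
  constructor
  · rintro ⟨-, e, he⟩
    rcases Sym2.eq_iff.1 he with ⟨h, h'⟩ | ⟨h, h'⟩
    · left; rw [← h, ← h']
    · right; rw [← h, ← h']
  · rintro (rfl | rfl)
    · exact ⟨(Int.lt_succ v).ne, ⟨(v, false), by simp⟩, rfl⟩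
    · exact ⟨(Int.lt_succ w).ne', ⟨(w, false), by simp⟩, Sym2.eq_swap⟩

theorem line_skeleton_eq : (line ξ c).skeleton = (line ξ d).skeleton := by
  ext v w
  exact (line_skeleton_adj ξ c v w).trans (line_skeleton_adj ξ d v w).symm

theorem line_connected : (line ξ c).skeleton.Connected := by
  have h (n : ℤ) : (line ξ c).skeleton.Reachable (0 : ℤ) n := by
    induction n using Int.induction_on with
    | zero => rfl
    | succ i ih => exact ih.trans ((line_skeleton_adj ξ c _ _).2 (.inl rfl)).reachable
    | pred i ih =>
      exact ih.trans ((line_skeleton_adj ξ c _ _).2 (.inr (sub_add_cancel _ _).symm)).reachable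
  exact { preconnected := fun v w => (h v).symm.trans (h w), nonempty := ⟨(0 : ℤ)⟩ }

theorem line_locallyFinite (v : ℤ) : {e | v ∈ (line ξ c).ends e}.Finite := by
  refine Set.Finite.of_finite_image (f := Subtype.val) (Set.Finite.subset
    (Set.toFinite (({v, v - 1} : Set ℤ) ×ˢ (Set.univ : Set Bool))) ?_) Subtype.val_injective.injOn
  rintro _ ⟨e, he, rfl⟩
  refine ⟨?_, trivial⟩
  rcases Sym2.mem_iff.1 he with h | h
  · exact .inl h.symm
  · exact .inr (eq_sub_of_add_eq h.symm)

/-- Multiplicities can be read off from the graph. -/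
theorem line_double_iff (n : ℤ) :
    c n = true ↔ ∃ e f : (line ξ c).E, e ≠ f ∧ (line ξ c).ends e = s(n, n + 1) ∧
      (line ξ c).ends f = s(n, n + 1) := by
  constructor
  · intro h
    exact ⟨⟨(n, false), by simp⟩, ⟨(n, true), fun _ => h⟩,
      fun he => Bool.false_ne_true (congrArg (fun e : (line ξ c).E => e.1.2) he), rfl, rfl⟩
  · have key {m : ℤ} (h : s(m, m + 1) = s(n, n + 1)) : m = n := by
      rcases Sym2.eq_iff.1 h with ⟨h, -⟩ | ⟨h, h'⟩ <;> omega
    rintro ⟨⟨⟨k, a⟩, ha⟩, ⟨⟨l, b⟩, hb⟩, hne, he, hf⟩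
    obtain rfl := key he
    obtain rfl := key hf
    -- Two distinct edges over the same integer cannot both carry the label `false`, and an edge
    -- labelled `true` exists only where the sequence is true.
    cases a
    · cases b
      · exact (hne rfl).elim
      · exact hb rfl
    · exact ha rfl

/-- The isomorphism of lines induced by a shift. -/
def lineShift (k : ℤ) : GraphIso (line ξ (fun n => c (n + k))) (line ξ c) where
  onV := (Equiv.addRight k : ℤ ≃ ℤ)
  onE := ((Equiv.addRight k).prodCongr (Equiv.refl Bool)).subtypeEquiv fun _ => Iff.rfl
  ends_map e := by
    change s(e.1.1 + k, e.1.1 + k + 1) = s(e.1.1 + k, e.1.1 + 1 + k)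
    rw [add_right_comm]

variable {ξ c d}

/-- Isomorphic lines are obtained from each other by a shift or a reflection. -/
theorem GraphIso.line_eq (φ : GraphIso (line ξ c) (line ξ d)) :
    ∃ a : ℤ, c = (fun n => d (a + n)) ∨ c = fun n => d (a - n) := by
  let f : ℤ → ℤ := φ.onV
  have hf : Function.Injective f := φ.onV.injective
  have hstep (n : ℤ) : f (n + 1) = f n + 1 ∨ f (n + 1) = f n - 1 := by
    have h := (line_skeleton_adj ξ d _ _).1
      (φ.adj_map ((line_skeleton_adj ξ c n (n + 1)).2 (.inl rfl)))
    change f (n + 1) = f n + 1 ∨ f n = f (n + 1) + 1 at h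
    omega
  have hends (n m : ℤ) (h : s(f n, f (n + 1)) = s(m, m + 1)) : c n = d m := by
    rw [Bool.eq_iff_iff, line_double_iff ξ c, line_double_iff ξ d]
    have hmap (e : (line ξ c).E) : (line ξ d).ends (φ.onE e) = s(m, m + 1) ↔
        (line ξ c).ends e = s(n, n + 1) := by
      rw [φ.ends_map, ← h]
      exact (Sym2.map.injective φ.onV.injective).eq_iff (b := s(n, n + 1))
    constructor
    · rintro ⟨e, e', hne, he, he'⟩
      exact ⟨φ.onE e, φ.onE e', φ.onE.injective.ne hne, (hmap e).2 he, (hmap e').2 he'⟩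
    · rintro ⟨e, e', hne, he, he'⟩
      obtain ⟨e, rfl⟩ := φ.onE.surjective e
      obtain ⟨e', rfl⟩ := φ.onE.surjective e'
      exact ⟨e, e', fun h => hne (congrArg _ h), (hmap e).1 he, (hmap e').1 he'⟩
  rcases Int.eq_add_or_eq_sub_of_injective hf hstep with h | h
  · refine ⟨f 0, .inl (funext fun n => hends n _ ?_)⟩
    rw [h n, h (n + 1), add_assoc]
  -- A reflection exchanges the end points: the image of the edge from `n` to `n + 1` has left end
  -- `f 0 - (n + 1)`, hence the offset `-1`.
  · refine ⟨f 0 - 1, .inr (funext fun n => hends n _ ?_)⟩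
    rw [h n, h (n + 1), Sym2.eq_swap, show f 0 - (n + 1) = f 0 - 1 - n by ring,
      show f 0 - n = f 0 - 1 - n + 1 by ring]

end MarkedGraph

open MarkedGraph

/-! ### The encoding of sequences by networks -/

section LineNetwork

variable {Ξ : Type u} (ξ : Ξ) (c d : ℤ → Bool)

/-- The line as a network rooted at `0`. -/
def rootedLine : RootedNetwork Ξ where
  toMarkedGraph := line ξ c
  connected := line_connected ξ c
  locallyFinite := line_locallyFinite ξ c
  root := (0 : ℤ)

/-- The isomorphism class of the line rooted at `0`. -/
def rootedLineClass : RootedSpace Ξ := Quotient.mk _ (rootedLine ξ c)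

theorem forgetRoot_rootedLineClass_shift (k : ℤ) :
    forgetRoot (rootedLineClass ξ (shiftHomeomorph Bool k c)) =
      forgetRoot (rootedLineClass ξ c) :=
  Quotient.sound (s := Network.isoSetoid Ξ)
    ⟨lineShift ξ c k, fun _ => rfl, fun _ _ _ => rfl⟩

/-- Relative to one member `d` of the fibre, every other member is determined by an integer and an
orientation. -/
theorem countable_forgetRoot_rootedLineClass_eq (x : NonRootedSpace Ξ) :
    {c | forgetRoot (rootedLineClass ξ c) = x}.Countable := by
  rcases Set.eq_empty_or_nonempty {c | forgetRoot (rootedLineClass ξ c) = x} with h | ⟨d, rfl⟩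
  · rw [h]
    exact Set.countable_empty
  refine ((Set.countable_range fun a : ℤ => fun n => d (a + n)).union
    (Set.countable_range fun a : ℤ => fun n => d (a - n))).mono fun c hc => ?_
  obtain ⟨φ, -⟩ := Quotient.exact (s := Network.isoSetoid Ξ) hc
  obtain ⟨a, h | h⟩ := GraphIso.line_eq φ
  · exact .inl ⟨a, h.symm⟩
  · exact .inr ⟨a, h.symm⟩

theorem ballSet_rootedLine_subset (n : ℕ) :
    (rootedLine ξ c).ballSet n ⊆ (Set.Icc (-n : ℤ) n : Set ℤ) := by
  intro (v : ℤ) hv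
  replace hv : (line ξ c).skeleton.edist (0 : ℤ) v ≤ n := hv
  obtain ⟨p, hp⟩ := ((line_connected ξ c).preconnected (0 : ℤ) v).exists_walk_length_eq_edist
  have h := SimpleGraph.Walk.abs_sub_le_length (G := (line ξ c).skeleton)
    (fun a b => (line_skeleton_adj ξ c a b).1) p
  rw [← hp, Nat.cast_le] at hv
  rw [sub_zero] at h
  exact abs_le.1 (h.trans (Nat.cast_le.2 hv))

variable {c d}

/-- Balls around `0` of two lines agree if the multiplicities agree on the ball. -/
def rootedLineBallIso (n : ℕ) (h : ∀ k : ℤ, k ∈ (Set.Icc (-n : ℤ) n : Set ℤ) → c k = d k) :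
    GraphIso ((rootedLine ξ c).ball n) ((rootedLine ξ d).ball n) :=
  have hS : (rootedLine ξ c).ballSet n = (rootedLine ξ d).ballSet n := by
    change {v | (line ξ c).skeleton.edist (0 : ℤ) v ≤ n} = _
    rw [line_skeleton_eq ξ c d]
    rfl
  { onV := Equiv.setCongr hS
    onE :=
      -- The left end of an edge in the ball lies in `[-n, n]`, where `c` and `d` agree, so the same
      -- label is admissible on both sides.
      { toFun := fun e => ⟨⟨e.1.1, fun hb => (h _ (ballSet_rootedLine_subset ξ c n
            (e.2 _ (Sym2.mem_mk_left _ _)))).symm.trans (e.1.2 hb)⟩,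
            fun v hv => hS ▸ e.2 v hv⟩
        invFun := fun e => ⟨⟨e.1.1, fun hb => (h _ (ballSet_rootedLine_subset ξ d n
            (e.2 _ (Sym2.mem_mk_left _ _)))).trans (e.1.2 hb)⟩,
            fun v hv => hS.symm ▸ e.2 v hv⟩
        left_inv := fun _ => rfl
        right_inv := fun _ => rfl }
    ends_map := fun e => by
      apply Sym2.map.injective Subtype.val_injective
      rfl }

variable [MetricSpace Ξ]

theorem le_agreement_rootedLineClass {n : ℕ} (hn : 0 < n)
    (h : ∀ k : ℤ, k ∈ (Set.Icc (-n : ℤ) n : Set ℤ) → c k = d k) :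
    (n : ℝ≥0∞) ≤ RootedSpace.agreement (rootedLineClass ξ c) (rootedLineClass ξ d) := by
  have hpos : (0 : ℝ) < 1 / ((n : ℝ≥0) : ℝ) := by simpa using hn
  refine le_iSup₂_of_le (n : ℝ≥0) ⟨by exact_mod_cast hn, ?_⟩ (by simp)
  refine ⟨rootedLineBallIso ξ ⌊(n : ℝ≥0)⌋₊ (by simpa using h), rfl, fun v => ?_, fun v e _ => ?_⟩
  · exact (dist_self ξ).trans_lt hpos
  · exact (dist_self ξ).trans_lt hpos

/-- A ball sees only finitely many coordinates, and agreement on finitely many coordinates is an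
open condition in the product topology. -/
theorem continuous_rootedLineClass : Continuous (rootedLineClass ξ) := by
  refine ⟨fun U hU => isOpen_iff_mem_nhds.2 fun c hc => ?_⟩
  obtain ⟨ε, hε, hεU⟩ := hU _ hc
  obtain ⟨n, hn⟩ := exists_nat_one_div_lt hε
  have hev : ∀ᶠ d in 𝓝 c, ∀ k ∈ Set.Icc (-(n + 1 : ℕ) : ℤ) (n + 1 : ℕ), c k = d k := by
    refine (eventually_all_finite (Set.finite_Icc _ _)).2 fun k _ => ?_
    filter_upwards [(continuous_apply k).continuousAt.preimage_mem_nhds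
      ((isOpen_discrete {c k}).mem_nhds rfl)] with d hd using hd.symm
  filter_upwards [hev] with d hd
  refine hεU _ (lt_of_le_of_lt ?_ hn)
  have h := le_agreement_rootedLineClass ξ n.succ_pos hd
  -- Agreement on `[-(n + 1), n + 1]` makes the agreement at least `n + 1`; the extra `1` in the
  -- denominator is dropped.
  have h' : 1 / (1 + RootedSpace.agreement (rootedLineClass ξ c) (rootedLineClass ξ d)) ≤
      1 / ((n + 1 : ℕ) : ℝ≥0∞) :=
    ENNReal.div_le_div_left (h.trans le_add_self) 1
  refine (ENNReal.toReal_mono (by simp) h').trans_eq ?_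
  rw [ENNReal.toReal_div, ENNReal.toReal_natCast, ENNReal.toReal_one, Nat.cast_add_one]

theorem measurable_forgetRoot_rootedLineClass :
    Measurable fun c => forgetRoot (rootedLineClass ξ c) := by
  have h : Measurable (rootedLineClass ξ) :=
    @Continuous.measurable _ _ _ _ _ _ _ ⟨rfl⟩ _ (continuous_rootedLineClass ξ)
  exact fun s hs => h hs

end LineNetwork

/-! ### Failure of countable separation -/

theorem not_countablySeparated_nonRootedSpace (Ξ : Type u) [MetricSpace Ξ] [Nonempty Ξ] :
    ¬ MeasurableSpace.CountablySeparated (NonRootedSpace Ξ) := by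
  intro hsep
  obtain ⟨ξ⟩ := ‹Nonempty Ξ›
  obtain ⟨g, hg, hinj⟩ :=
    MeasurableSpace.measurable_injection_nat_bool_of_countablySeparated (NonRootedSpace Ξ)
  obtain ⟨y, hy⟩ := (hg.comp (measurable_forgetRoot_rootedLineClass ξ)).exists_residual_eq_const_of_invariant
    (shiftHomeomorph Bool) exists_shiftHomeomorph_preimage_inter_nonempty
    fun k c => congrArg (g ·) (forgetRoot_rootedLineClass_shift ξ c k)
  refine Set.not_countable_of_mem_residual hy ?_
  obtain ⟨d, hd⟩ := (dense_of_mem_residual hy).nonempty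
  refine (countable_forgetRoot_rootedLineClass_eq ξ (forgetRoot (rootedLineClass ξ d))).mono
    fun c hc => hinj (hc.trans hd.symm)

theorem mainTheorem11 (Ξ : Type u) [MetricSpace Ξ] [CompleteSpace Ξ]
    [TopologicalSpace.SeparableSpace Ξ] [Nonempty Ξ] :
    ¬ StandardBorelSpace (NonRootedSpace Ξ) ∧
      ¬ ∃ m : MetricSpace (NonRootedSpace Ξ),
        @PolishSpace (NonRootedSpace Ξ) m.toUniformSpace.toTopologicalSpace ∧
          @borel (NonRootedSpace Ξ) m.toUniformSpace.toTopologicalSpace = sigmaJ Ξ := by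
  have h : ¬ StandardBorelSpace (NonRootedSpace Ξ) := fun _ =>
    not_countablySeparated_nonRootedSpace Ξ inferInstance
  exact ⟨h, fun ⟨m, hm, hb⟩ => h ⟨⟨m.toUniformSpace.toTopologicalSpace, ⟨hb.symm⟩, hm⟩⟩⟩
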